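/- Let $\mu$ be a finite Borel measure on $\mathbb{C}$ whose support is compact and infinite. Let $\varphi_n$ ($n\ge 0$) be its orthonormal polynomials, obtained by applying the Gram--Schmidt process in $L^2(\mathbb{C},\mu)$ to $1,z,z^2,\dots$ and normalized so that $\varphi_n$ has degree $n$ and positive leading coefficient $\kappa_n$, and let $\Phi_n=\kappa_n^{-1}\varphi_n$ be the monic orthogonal polynomials. Suppose that $$\lim_{n\to\infty}\frac{\kappa_n}{\kappa_{n+1}}=0$$ and that there is a number $x\in\mathbb{C}$ such that $$\lim_{n\to\infty}\left(\left[\frac{z^2\,\Phi_n(z)}{\Phi_{n+1}(z)}-z\right]\bigg|_{z=\infty}\right)=x,$$ where the value at $z=\infty$ of the function in brackets, for each fixed $n$, is its limit as $|z|\to\infty$ (this limit always exists). Then for every integer $j\ge 0$ (with $x^0=1$), $$\lim_{n\to\infty}\int_{\mathbb{C}}z^j\,|\varphi_n(z)|^2\,d\mu(z)=x^j.$$ -/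

import Mathlib

open Filter Topology MeasureTheory Polynomial
open scoped ComplexConjugate

noncomputable section

namespace OrthoPoly

/-- The `L²(μ)` inner product `∫ p q̄ dμ` of two polynomials. -/
def polyInner (μ : Measure ℂ) (p q : ℂ[X]) : ℂ :=
  ∫ z, p.eval z * conj (q.eval z) ∂μ

/-- The monic orthogonal polynomials `Φ_n`, obtained by applying the (unnormalized)
Gram-Schmidt process in `L²(μ)` to the sequence `1, z, z², …`. -/
def monicOP (μ : Measure ℂ) (n : ℕ) : ℂ[X] :=
  X ^ n - ∑ k : Fin n,
    C (polyInner μ (X ^ n) (monicOP μ k) / polyInner μ (monicOP μ k) (monicOP μ k)) * monicOP μ k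
termination_by n
decreasing_by exact k.2

/-- The normalization constant `κ_n = ‖Φ_n‖⁻¹`, the norm being that of `L²(μ)`. As `Φ_n` is monic,
this is the leading coefficient of the orthonormal polynomial `φ_n`. -/
def kappa (μ : Measure ℂ) (n : ℕ) : ℝ :=
  (√(∫ z, ‖(monicOP μ n).eval z‖ ^ 2 ∂μ))⁻¹

/-- The orthonormal polynomials `φ_n = κ_n Φ_n`. -/
def orthonormalPoly (μ : Measure ℂ) (n : ℕ) : ℂ[X] :=
  C (kappa μ n : ℂ) * monicOP μ n

/-- The value at `z = ∞` of a function on the plane: its limit as `|z| → ∞`. -/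
def valueAtInfinity (f : ℂ → ℂ) : ℂ :=
  limUnder (Bornology.cobounded ℂ) f

theorem monicOP_monic_natDegree (μ : Measure ℂ) (n : ℕ) :
    (monicOP μ n).Monic ∧ (monicOP μ n).natDegree = n := by
  induction n using Nat.strong_induction_on with
  | _ n ih =>
    have hlt : (∑ k : Fin n,
        C (polyInner μ (X ^ n) (monicOP μ k) / polyInner μ (monicOP μ k) (monicOP μ k)) *
          monicOP μ k).degree < ((X : ℂ[X]) ^ n).degree := by
      rw [degree_X_pow]
      refine (degree_sum_le _ _).trans_lt ((Finset.sup_lt_iff (WithBot.bot_lt_coe n)).2 ?_)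
      intro k _
      rw [← smul_eq_C_mul]
      refine (degree_smul_le _ _).trans_lt ?_
      rw [degree_eq_natDegree (ih k k.2).1.ne_zero, (ih k k.2).2]
      exact WithBot.coe_lt_coe.2 k.2
    rw [monicOP]
    refine ⟨(monic_X_pow n).sub_of_left hlt, ?_⟩
    rw [natDegree_eq_of_degree_eq (degree_sub_eq_left_of_degree_lt hlt), natDegree_X_pow]

/-- The value at infinity of `z² Φ_n / Φ_{n+1} - z` is an honest limit. -/
theorem tendsto_valueAtInfinity (μ : Measure ℂ) (n : ℕ) :
    Tendsto (fun z : ℂ => z ^ 2 * (monicOP μ n).eval z / (monicOP μ (n + 1)).eval z - z)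
      (Bornology.cobounded ℂ)
      (𝓝 (valueAtInfinity fun z : ℂ =>
        z ^ 2 * (monicOP μ n).eval z / (monicOP μ (n + 1)).eval z - z)) := by
  refine tendsto_nhds_limUnder ?_
  obtain ⟨hP, hPd⟩ := monicOP_monic_natDegree μ n
  obtain ⟨hQ, hQd⟩ := monicOP_monic_natDegree μ (n + 1)
  set P := monicOP μ n
  set Q := monicOP μ (n + 1)
  have hXP : (X * P).natDegree = n + 1 := by rw [natDegree_X_mul hP.ne_zero, hPd]
  have hR : (X * (X * P - Q)).natDegree ≤ n + 1 := by
    have hlt : (X * P - Q).degree < (X * P).degree := by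
      refine degree_sub_lt_left ?_ (monic_X.mul hP).ne_zero ?_
      · rw [degree_eq_natDegree (monic_X.mul hP).ne_zero, degree_eq_natDegree hQ.ne_zero, hXP, hQd]
      · rw [(monic_X.mul hP).leadingCoeff, hQ.leadingCoeff]
    rw [degree_eq_natDegree (monic_X.mul hP).ne_zero, hXP] at hlt
    by_cases h0 : X * P - Q = 0
    · simp [h0]
    · rw [natDegree_X_mul h0]
      have := (natDegree_lt_iff_degree_lt h0).2 hlt
      omega
  have key : ∀ p : ℂ[X], p.natDegree ≤ n + 1 → ∀ z : ℂ, z ≠ 0 →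
      p.eval z = (reflect (n + 1) p).eval z⁻¹ * z ^ (n + 1) := by
    intro p hp z hz
    let _ := invertibleOfNonzero hz
    have h := eval₂_reflect_mul_pow (RingHom.id ℂ) z (n + 1) p hp
    rw [invOf_eq_inv] at h
    exact h.symm
  have hlim : ∀ p : ℂ[X], Tendsto (fun z : ℂ => (reflect (n + 1) p).eval z⁻¹)
      (Bornology.cobounded ℂ) (𝓝 ((reflect (n + 1) p).eval 0)) := fun p =>
    ((reflect (n + 1) p).continuous.tendsto 0).comp tendsto_inv₀_cobounded
  have hQ0 : (reflect (n + 1) Q).eval 0 = 1 := by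
    rw [← coeff_zero_eq_eval_zero, coeff_reflect, revAt_le (Nat.zero_le _)]
    simpa [hQd] using hQ.coeff_natDegree
  have hdiv := (hlim (X * (X * P - Q))).div (hlim Q) (by rw [hQ0]; exact one_ne_zero)
  refine ⟨_, hdiv.congr' ?_⟩
  have hne : ∀ᶠ z in Bornology.cobounded ℂ, (reflect (n + 1) Q).eval z⁻¹ ≠ 0 :=
    (hlim Q).eventually_ne (by rw [hQ0]; exact one_ne_zero)
  filter_upwards [hne, Bornology.eventually_ne_cobounded (0 : ℂ)] with z hz hz0
  have h1 := key _ hR z hz0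
  have h2 := key Q hQd.le z hz0
  have h3 : Q.eval z ≠ 0 := by
    rw [h2]
    exact mul_ne_zero hz (pow_ne_zero _ hz0)
  simp only [Pi.div_apply]
  rw [← mul_div_mul_right _ _ (pow_ne_zero (n + 1) hz0), ← h1, ← h2]
  simp only [eval_mul, eval_X, eval_sub]
  field_simp

end OrthoPoly

end

noncomputable section

namespace OrthoPoly

variable {μ : Measure ℂ}

/-! Write `b n` for the coefficient of degree `n` in `zΦ_n - Φ_{n+1}`; it is the value of the
bracket at infinity (`valueAtInfinity_eq_coeff`). Then `zφ_n = (κ_n/κ_{n+1}) φ_{n+1} + b n φ_n +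
(degree < n)`, so `zφ_n` is `xφ_n` up to an `L²`-null error and terms of degree `< n`. This iterates
to `z^j φ_n ≈ x^j φ_n`: multiplying the low-degree part by `z` leaks into degree `n` only by a term
of size `O(κ_{n-1}/κ_n)` (`exists_X_mul_eq_add`), because multiplication by `z` is bounded on the
compact support. Pairing with `φ_n` kills the low degrees and leaves `x^j`. -/

theorem ae_norm_le_of_isCompact_support (hc : IsCompact μ.support) :
    ∃ R : ℝ, 0 ≤ R ∧ ∀ᵐ z ∂μ, ‖z‖ ≤ R := by
  obtain ⟨R, hR⟩ := hc.isBounded.exists_norm_le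
  refine ⟨max R 0, le_max_right _ _, ?_⟩
  filter_upwards [μ.support_mem_ae] with z hz using (hR z hz).trans (le_max_left _ _)

/-! ### Polynomials as vectors of `L²(μ)`. -/

variable [IsFiniteMeasure μ]

theorem memLp_eval (hc : IsCompact μ.support) (p : ℂ[X]) :
    MemLp (fun z => p.eval z) 2 μ := by
  obtain ⟨C, hC⟩ := hc.exists_bound_of_continuousOn (f := fun z => p.eval z)
    p.continuous.continuousOn
  refine MemLp.of_bound p.continuous.aestronglyMeasurable C ?_
  filter_upwards [μ.support_mem_ae] with z hz using hC z hz

/-- The class in `L²(μ)` of a polynomial, for a finite measure of compact support. -/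
def toL2 (hc : IsCompact μ.support) : ℂ[X] →ₗ[ℂ] Lp ℂ 2 μ where
  toFun p := (memLp_eval hc p).toLp _
  map_add' p q := by
    rw [← MemLp.toLp_add]
    exact MemLp.toLp_congr _ _ (ae_of_all _ fun z => eval_add)
  map_smul' c p := by
    rw [RingHom.id_apply, ← MemLp.toLp_const_smul]
    exact MemLp.toLp_congr _ _ (ae_of_all _ fun z => eval_smul _ _ _)

theorem coeFn_toL2 (hc : IsCompact μ.support) (p : ℂ[X]) :
    toL2 hc p =ᵐ[μ] fun z => p.eval z :=
  (memLp_eval hc p).coeFn_toLp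

theorem inner_toL2 (hc : IsCompact μ.support) (p q : ℂ[X]) :
    inner ℂ (toL2 hc q) (toL2 hc p) = polyInner μ p q := by
  rw [L2.inner_def, polyInner]
  refine integral_congr_ae ?_
  filter_upwards [coeFn_toL2 hc p, coeFn_toL2 hc q] with z hp hq
  rw [hp, hq, RCLike.inner_apply]

theorem norm_toL2 (hc : IsCompact μ.support) (p : ℂ[X]) :
    ‖toL2 hc p‖ = √(∫ z, ‖p.eval z‖ ^ 2 ∂μ) := by
  have h : ((‖toL2 hc p‖ ^ 2 : ℝ) : ℂ) = ((∫ z, ‖p.eval z‖ ^ 2 ∂μ : ℝ) : ℂ) := by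
    have h1 := inner_self_eq_norm_sq_to_K (𝕜 := ℂ) (toL2 hc p)
    rw [inner_toL2] at h1
    rw [← integral_complex_ofReal]
    push_cast
    refine h1.symm.trans (integral_congr_ae (ae_of_all _ fun z => ?_))
    simp [Complex.mul_conj']
  rw [← Complex.ofReal_injective h, Real.sqrt_sq (norm_nonneg _)]

/-- The zero set of `p` is closed, so if it has full measure it contains the support, which is
infinite. -/
theorem toL2_ne_zero (hc : IsCompact μ.support) (hinf : μ.support.Infinite) {p : ℂ[X]}
    (hp : p ≠ 0) : toL2 hc p ≠ 0 := by
  intro h0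
  have hae : ∀ᵐ z ∂μ, p.eval z = 0 := by
    have h := coeFn_toL2 hc p
    rw [h0] at h
    filter_upwards [h, Lp.coeFn_zero ℂ 2 μ] with z h1 h2
    rw [← h1, h2, Pi.zero_apply]
  refine hinf ((p.roots.toFinset.finite_toSet).subset ?_)
  have hcl : IsClosed {z : ℂ | p.eval z = 0} := isClosed_eq p.continuous continuous_const
  refine (μ.support_subset_of_isClosed hcl hae).trans fun z hz => ?_
  simpa [hp] using hz

theorem norm_toL2_X_mul_le (hc : IsCompact μ.support) :
    ∃ R : ℝ, 0 ≤ R ∧ ∀ p : ℂ[X], ‖toL2 hc (X * p)‖ ≤ R * ‖toL2 hc p‖ := by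
  obtain ⟨R, hR0, hR⟩ := ae_norm_le_of_isCompact_support hc
  refine ⟨R, hR0, fun p => Lp.norm_le_mul_norm_of_ae_le_mul ?_⟩
  filter_upwards [hR, coeFn_toL2 hc p, coeFn_toL2 hc (X * p)] with z h h1 h2
  rw [h1, h2, eval_mul, eval_X, norm_mul]
  gcongr

/-! ### Orthogonality and extremality of `Φ_n`. -/

theorem norm_toL2_monicOP_pos (hc : IsCompact μ.support) (hinf : μ.support.Infinite) (n : ℕ) :
    0 < ‖toL2 hc (monicOP μ n)‖ :=
  norm_pos_iff.2 (toL2_ne_zero hc hinf (monicOP_monic_natDegree μ n).1.ne_zero)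

theorem inner_monicOP_of_lt (hc : IsCompact μ.support) (hinf : μ.support.Infinite) (n : ℕ) :
    ∀ m < n, inner ℂ (toL2 hc (monicOP μ m)) (toL2 hc (monicOP μ n)) = 0 := by
  induction n using Nat.strong_induction_on with
  | _ n ih =>
    intro m hm
    have hoff : ∀ k : Fin n, k ≠ ⟨m, hm⟩ →
        inner ℂ (toL2 hc (monicOP μ m)) (toL2 hc (monicOP μ k)) = 0 := by
      intro k hk
      -- Both indices are below `n`, so the induction hypothesis applies at the larger one.
      rcases lt_or_gt_of_ne (fun h : (k : ℕ) = m => hk (Fin.ext h)) with h | h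
      · exact inner_eq_zero_symm.1 (ih m hm k h)
      · exact ih k k.2 m h
    have hself : inner ℂ (toL2 hc (monicOP μ m)) (toL2 hc (monicOP μ m)) ≠ 0 :=
      inner_self_ne_zero.2 (norm_pos_iff.1 (norm_toL2_monicOP_pos hc hinf m))
    rw [monicOP.eq_def μ n, map_sub, map_sum, inner_sub_right, inner_sum,
      Finset.sum_eq_single ⟨m, hm⟩ _ (by simp)]
    · rw [← smul_eq_C_mul, map_smul, inner_smul_right, ← inner_toL2 hc, ← inner_toL2 hc,
        div_mul_cancel₀ _ hself, sub_self]
    · intro k _ hk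
      rw [← smul_eq_C_mul, map_smul, inner_smul_right, hoff k hk, mul_zero]

theorem degree_sub_coeff_smul_monicOP_lt (μ : Measure ℂ) {p : ℂ[X]} {n : ℕ}
    (hp : p.degree < ((n + 1 : ℕ) : WithBot ℕ)) : (p - p.coeff n • monicOP μ n).degree < n := by
  obtain ⟨hm, hd⟩ := monicOP_monic_natDegree μ n
  rw [degree_lt_iff_coeff_zero] at hp ⊢
  intro m hnm
  rw [coeff_sub, coeff_smul, smul_eq_mul]
  rcases hnm.eq_or_lt with rfl | h
  · have h1 : (monicOP μ n).coeff n = 1 := by simpa [hd] using hm.coeff_natDegree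
    rw [h1, mul_one, sub_self]
  · rw [hp m h, coeff_eq_zero_of_natDegree_lt (by omega : _ < m), mul_zero, sub_zero]

theorem inner_monicOP_of_degree_lt (hc : IsCompact μ.support) (hinf : μ.support.Infinite)
    {n : ℕ} {p : ℂ[X]} (hp : p.degree < n) :
    inner ℂ (toL2 hc (monicOP μ n)) (toL2 hc p) = 0 := by
  suffices h : ∀ d ≤ n, ∀ q : ℂ[X], q.degree < d →
      inner ℂ (toL2 hc (monicOP μ n)) (toL2 hc q) = 0 from h n le_rfl p hp
  intro d
  induction d with
  | zero =>
    intro _ q hq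
    rw [degree_lt_iff_coeff_zero] at hq
    have : q = 0 := by ext m; simpa using hq m (Nat.zero_le _)
    simp [this]
  | succ d ih =>
    intro hd q hq
    have h := ih (by omega) _ (degree_sub_coeff_smul_monicOP_lt μ hq)
    rwa [map_sub, map_smul, inner_sub_right, inner_smul_right,
      inner_eq_zero_symm.1 (inner_monicOP_of_lt hc hinf n d hd), mul_zero, sub_zero] at h

/-- Extremality of `Φ_n` among monic polynomials: `⟨Φ_n, p⟩` equals the top coefficient times
`‖Φ_n‖²`, and Cauchy–Schwarz bounds it. -/
theorem norm_coeff_mul_norm_monicOP_le (hc : IsCompact μ.support) (hinf : μ.support.Infinite)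
    {n : ℕ} {p : ℂ[X]} (hp : p.degree < ((n + 1 : ℕ) : WithBot ℕ)) :
    ‖p.coeff n‖ * ‖toL2 hc (monicOP μ n)‖ ≤ ‖toL2 hc p‖ := by
  have hpos := norm_toL2_monicOP_pos hc hinf n
  have h := inner_monicOP_of_degree_lt hc hinf (degree_sub_coeff_smul_monicOP_lt μ hp)
  rw [map_sub, map_smul, inner_sub_right, inner_smul_right, inner_self_eq_norm_sq_to_K,
    sub_eq_zero] at h
  have h2 := norm_inner_le_norm (𝕜 := ℂ) (toL2 hc (monicOP μ n)) (toL2 hc p)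
  rw [h, norm_mul, norm_pow, RCLike.norm_ofReal, abs_norm] at h2
  refine le_of_mul_le_mul_left ?_ hpos
  linarith

theorem kappa_eq (hc : IsCompact μ.support) (n : ℕ) :
    kappa μ n = ‖toL2 hc (monicOP μ n)‖⁻¹ := by
  rw [kappa, norm_toL2]

theorem norm_toL2_orthonormalPoly (hc : IsCompact μ.support) (hinf : μ.support.Infinite) (n : ℕ) :
    ‖toL2 hc (orthonormalPoly μ n)‖ = 1 := by
  have hpos := norm_toL2_monicOP_pos hc hinf n
  rw [orthonormalPoly, ← smul_eq_C_mul, map_smul, norm_smul, kappa_eq hc, Complex.norm_real,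
    norm_inv, norm_norm, inv_mul_cancel₀ hpos.ne']

theorem norm_kappa_smul_toL2_monicOP_succ (hc : IsCompact μ.support) (n : ℕ) :
    ‖toL2 hc ((kappa μ n : ℂ) • monicOP μ (n + 1))‖ = kappa μ n / kappa μ (n + 1) := by
  rw [map_smul, norm_smul, kappa_eq hc, kappa_eq hc, Complex.norm_real, norm_inv, norm_norm,
    div_inv_eq_mul]

theorem inner_orthonormalPoly_of_degree_lt (hc : IsCompact μ.support) (hinf : μ.support.Infinite)
    {n : ℕ} {p : ℂ[X]} (hp : p.degree < n) :
    inner ℂ (toL2 hc (orthonormalPoly μ n)) (toL2 hc p) = 0 := by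
  rw [orthonormalPoly, ← smul_eq_C_mul, map_smul, inner_smul_left,
    inner_monicOP_of_degree_lt hc hinf hp, mul_zero]

/-! ### The value at infinity as a recurrence coefficient. -/

theorem tendsto_eval_div_pow_cobounded {p : ℂ[X]} {n : ℕ} (hp : p.natDegree ≤ n) :
    Tendsto (fun z : ℂ => p.eval z / z ^ n) (Bornology.cobounded ℂ) (𝓝 (p.coeff n)) := by
  have hlim : Tendsto (fun z : ℂ => (reflect n p).eval z⁻¹) (Bornology.cobounded ℂ)
      (𝓝 ((reflect n p).eval 0)) :=
    ((reflect n p).continuous.tendsto 0).comp tendsto_inv₀_cobounded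
  have h0 : (reflect n p).eval 0 = p.coeff n := by
    rw [← coeff_zero_eq_eval_zero, coeff_reflect, revAt_le (Nat.zero_le _), Nat.sub_zero]
  rw [← h0]
  refine hlim.congr' ?_
  filter_upwards [Bornology.eventually_ne_cobounded (0 : ℂ)] with z hz
  let _ := invertibleOfNonzero hz
  have h := eval₂_reflect_mul_pow (RingHom.id ℂ) z n p hp
  rw [invOf_eq_inv] at h
  exact eq_div_of_mul_eq (pow_ne_zero _ hz) h

theorem degree_X_mul_monicOP_sub_lt (μ : Measure ℂ) (n : ℕ) :
    (X * monicOP μ n - monicOP μ (n + 1)).degree < ((n + 1 : ℕ) : WithBot ℕ) := by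
  obtain ⟨hP, hPd⟩ := monicOP_monic_natDegree μ n
  obtain ⟨hQ, hQd⟩ := monicOP_monic_natDegree μ (n + 1)
  have hXP : (X * monicOP μ n).degree = ((n + 1 : ℕ) : WithBot ℕ) := by
    rw [degree_eq_natDegree (monic_X.mul hP).ne_zero, natDegree_X_mul hP.ne_zero, hPd]
  rw [← hXP]
  refine degree_sub_lt_left ?_ (monic_X.mul hP).ne_zero ?_
  · rw [hXP, degree_eq_natDegree hQ.ne_zero, hQd]
  · rw [(monic_X.mul hP).leadingCoeff, hQ.leadingCoeff]

/-- The bracket is `z(zΦ_n - Φ_{n+1})/Φ_{n+1}`. The numerator has degree at most `n + 1` because the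
leading terms cancel; divide above and below by `z^(n+1)`. -/
theorem valueAtInfinity_eq_coeff (μ : Measure ℂ) (n : ℕ) :
    (valueAtInfinity fun z : ℂ =>
        z ^ 2 * (monicOP μ n).eval z / (monicOP μ (n + 1)).eval z - z) =
      (X * monicOP μ n - monicOP μ (n + 1)).coeff n := by
  obtain ⟨hQ, hQd⟩ := monicOP_monic_natDegree μ (n + 1)
  have hQ1 : (monicOP μ (n + 1)).coeff (n + 1) = 1 := by simpa [hQd] using hQ.coeff_natDegree
  have hD : (X * (X * monicOP μ n - monicOP μ (n + 1))).natDegree ≤ n + 1 := by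
    have h := natDegree_le_of_degree_le
      (Order.le_of_lt_succ (degree_X_mul_monicOP_sub_lt μ n) : _ ≤ ((n : ℕ) : WithBot ℕ))
    refine natDegree_mul_le.trans ?_
    rw [natDegree_X]
    omega
  have hlimQ := tendsto_eval_div_pow_cobounded hQd.le
  rw [hQ1] at hlimQ
  have hdiv := (tendsto_eval_div_pow_cobounded hD).div hlimQ one_ne_zero
  rw [div_one, coeff_X_mul] at hdiv
  refine tendsto_nhds_unique (tendsto_valueAtInfinity μ n) (hdiv.congr' ?_)
  filter_upwards [hlimQ.eventually_ne one_ne_zero, Bornology.eventually_ne_cobounded (0 : ℂ)]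
    with z hz hz0
  have hQz : (monicOP μ (n + 1)).eval z ≠ 0 := fun h => hz (by rw [h, zero_div])
  rw [Pi.div_apply, div_div_div_cancel_right₀ (pow_ne_zero _ hz0)]
  simp only [eval_mul, eval_X, eval_sub]
  field_simp

/-! ### Powers of `z` acting on `φ_n`. -/

theorem degree_X_mul_lt {p : ℂ[X]} {n : ℕ} (hp : p.degree < n) :
    (X * p).degree < ((n + 1 : ℕ) : WithBot ℕ) := by
  rw [degree_lt_iff_coeff_zero] at hp ⊢
  rintro (_ | m) hm
  · simp
  · rw [coeff_X_mul]
    exact hp m (by omega)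

/-- Multiplication by `X` raises the degree of a polynomial of degree less than `n` to `n` only
through a multiple of `Φ_n` whose norm is controlled by `κ_{n-1} / κ_n`. -/
theorem exists_X_mul_eq_add (hc : IsCompact μ.support) (hinf : μ.support.Infinite)
    {n : ℕ} {p : ℂ[X]} (hp : p.degree < n) :
    ∃ e q : ℂ[X], X * p = e + q ∧
      ‖toL2 hc e‖ ≤ ‖toL2 hc p‖ * (kappa μ (n - 1) / kappa μ n) ∧ q.degree < n := by
  -- At `n = 0` the truncated index `n - 1` is harmless, since `p = 0`.
  rcases n with _ | n
  · have hp0 : p = 0 := by simpa using hp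
    exact ⟨0, 0, by simp [hp0], by simp [hp0], by simp⟩
  refine ⟨p.coeff n • monicOP μ (n + 1), X * p - p.coeff n • monicOP μ (n + 1), by ring, ?_, ?_⟩
  · have hpos := norm_toL2_monicOP_pos hc hinf n
    have h := norm_coeff_mul_norm_monicOP_le hc hinf hp
    rw [map_smul, norm_smul, Nat.add_sub_cancel, kappa_eq hc, kappa_eq hc, div_inv_eq_mul,
      ← mul_assoc]
    gcongr
    rwa [← div_eq_mul_inv, le_div_iff₀ hpos]
  · have h := degree_sub_coeff_smul_monicOP_lt μ (degree_X_mul_lt hp)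
    rwa [coeff_X_mul] at h

theorem exists_norm_toL2_X_pow_mul_orthonormalPoly_le (hc : IsCompact μ.support)
    (hinf : μ.support.Infinite) (j : ℕ) :
    ∃ C : ℝ, ∀ n, ‖toL2 hc (X ^ j * orthonormalPoly μ n)‖ ≤ C := by
  obtain ⟨R, hR0, hR⟩ := norm_toL2_X_mul_le hc
  induction j with
  | zero => exact ⟨1, fun n => by simp [norm_toL2_orthonormalPoly hc hinf]⟩
  | succ j ih =>
    obtain ⟨C, hC⟩ := ih
    refine ⟨R * C, fun n => ?_⟩
    rw [pow_succ', mul_assoc]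
    exact (hR _).trans (mul_le_mul_of_nonneg_left (hC n) hR0)

/-- Up to an error tending to zero in `L²(μ)` and a polynomial of degree less than `n`, the
polynomial `z ^ j φ_n` is `x ^ j φ_n`. -/
theorem exists_X_pow_mul_orthonormalPoly_eq (hc : IsCompact μ.support)
    (hinf : μ.support.Infinite)
    (hkappa : Tendsto (fun n : ℕ => kappa μ n / kappa μ (n + 1)) atTop (𝓝 0)) {x : ℂ}
    (hx : Tendsto (fun n : ℕ => (X * monicOP μ n - monicOP μ (n + 1)).coeff n) atTop (𝓝 x))
    (j : ℕ) :
    ∃ e p : ℕ → ℂ[X],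
      (∀ n, X ^ j * orthonormalPoly μ n = x ^ j • orthonormalPoly μ n + e n + p n) ∧
      Tendsto (fun n => toL2 hc (e n)) atTop (𝓝 0) ∧ ∀ n, (p n).degree < n := by
  obtain ⟨R, -, hR⟩ := norm_toL2_X_mul_le hc
  induction j with
  | zero => exact ⟨0, 0, by simp, by simp, fun n => by simp⟩
  | succ j ih =>
    obtain ⟨e, p, hep, he, hp⟩ := ih
    obtain ⟨B, hB⟩ := exists_norm_toL2_X_pow_mul_orthonormalPoly_le hc hinf j
    choose e' q heq he' hq using fun n => exists_X_mul_eq_add hc hinf (hp n)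
    -- Solving the decomposition for `p n` bounds it uniformly up to a null term, which makes the
    -- leak `e' n` tend to zero.
    have hpn : ∀ n, ‖toL2 hc (p n)‖ ≤ B + ‖x ^ j‖ + ‖toL2 hc (e n)‖ := by
      intro n
      have h : p n = X ^ j * orthonormalPoly μ n - x ^ j • orthonormalPoly μ n - e n := by
        rw [hep n]; ring
      rw [h, map_sub, map_sub, map_smul]
      refine (norm_sub_le _ _).trans (add_le_add_left ((norm_sub_le _ _).trans ?_) _)
      rw [norm_smul, norm_toL2_orthonormalPoly hc hinf, mul_one]
      exact add_le_add_left (hB n) _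
    have he'0 : Tendsto (fun n => toL2 hc (e' n)) atTop (𝓝 0) := by
      have hk : Tendsto (fun n : ℕ => kappa μ (n - 1) / kappa μ n) atTop (𝓝 0) := by
        refine (tendsto_add_atTop_iff_nat 1).1 ?_
        simpa using hkappa
      have hlim := (he.norm.const_add (B + ‖x ^ j‖)).mul hk
      rw [mul_zero] at hlim
      refine squeeze_zero_norm (fun n => (he' n).trans ?_) hlim
      have hk0 : 0 ≤ kappa μ (n - 1) / kappa μ n := by
        rw [kappa_eq hc, kappa_eq hc]; positivity
      exact mul_le_mul_of_nonneg_right (hpn n) hk0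
    have hXe : Tendsto (fun n => toL2 hc (X * e n)) atTop (𝓝 0) := by
      refine squeeze_zero_norm (fun n => hR (e n)) ?_
      simpa using he.norm.const_mul R
    have hnext : Tendsto (fun n => toL2 hc ((kappa μ n : ℂ) • monicOP μ (n + 1))) atTop (𝓝 0) :=
      squeeze_zero_norm (fun n => (norm_kappa_smul_toL2_monicOP_succ hc n).le) hkappa
    set b : ℕ → ℂ := fun n => (X * monicOP μ n - monicOP μ (n + 1)).coeff n
    have hdiag : Tendsto (fun n => toL2 hc ((b n - x) • orthonormalPoly μ n)) atTop (𝓝 0) := by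
      refine squeeze_zero_norm (a := fun n => ‖b n - x‖) (fun n => ?_) ?_
      · rw [map_smul, norm_smul, norm_toL2_orthonormalPoly hc hinf, mul_one]
      · simpa using (hx.sub_const x).norm
    -- Multiply the decomposition for `j` by `X` and expand `X φ_n`. The null error collects the
    -- `Φ_{n+1}` term, the defect `b n - x`, `X * e n` and the leak `e' n`; what remains has degree
    -- below `n`.
    refine ⟨fun n => x ^ j • (kappa μ n : ℂ) • monicOP μ (n + 1) +
        x ^ j • (b n - x) • orthonormalPoly μ n + X * e n + e' n,
      fun n => (x ^ j * kappa μ n) •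
        (X * monicOP μ n - monicOP μ (n + 1) - b n • monicOP μ n) + q n, fun n => ?_, ?_, fun n => ?_⟩
    · rw [pow_succ', mul_assoc, hep n, mul_add, mul_add, heq n]
      simp only [orthonormalPoly, smul_eq_C_mul, map_sub, map_mul, map_pow]
      ring
    · simp only [map_add, map_smul (toL2 hc) (x ^ j)]
      simpa using (((hnext.const_smul (x ^ j)).add (hdiag.const_smul (x ^ j))).add hXe).add he'0
    · refine (degree_add_le _ _).trans_lt (max_lt ((degree_smul_le _ _).trans_lt ?_) (hq n))
      exact degree_sub_coeff_smul_monicOP_lt μ (degree_X_mul_monicOP_sub_lt μ n)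

theorem integral_pow_mul_norm_sq_eq_inner (hc : IsCompact μ.support) (p : ℂ[X]) (j : ℕ) :
    ∫ z, z ^ j * ((‖p.eval z‖ ^ 2 : ℝ) : ℂ) ∂μ = inner ℂ (toL2 hc p) (toL2 hc (X ^ j * p)) := by
  rw [inner_toL2, polyInner]
  refine integral_congr_ae (ae_of_all _ fun z => ?_)
  simp [mul_assoc, Complex.mul_conj']

end OrthoPoly

end

theorem theorem4p2 (μ : Measure ℂ) [IsFiniteMeasure μ]
    (hcompact : IsCompact μ.support) (hinf : μ.support.Infinite)
    (hkappa : Tendsto (fun n : ℕ => OrthoPoly.kappa μ n / OrthoPoly.kappa μ (n + 1)) atTop (𝓝 0))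
    (x : ℂ)
    (hx : Tendsto
      (fun n : ℕ => OrthoPoly.valueAtInfinity fun z : ℂ =>
        z ^ 2 * (OrthoPoly.monicOP μ n).eval z / (OrthoPoly.monicOP μ (n + 1)).eval z - z)
      atTop (𝓝 x)) (j : ℕ) :
    Tendsto
      (fun n : ℕ => ∫ z, z ^ j * ((‖(OrthoPoly.orthonormalPoly μ n).eval z‖ ^ 2 : ℝ) : ℂ) ∂μ)
      atTop (𝓝 (x ^ j)) := by
  simp only [OrthoPoly.valueAtInfinity_eq_coeff] at hx
  obtain ⟨e, p, hep, he, hp⟩ :=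
    OrthoPoly.exists_X_pow_mul_orthonormalPoly_eq hcompact hinf hkappa hx j
  have hlim : Tendsto (fun n => x ^ j + inner ℂ
      (OrthoPoly.toL2 hcompact (OrthoPoly.orthonormalPoly μ n)) (OrthoPoly.toL2 hcompact (e n)))
      atTop (𝓝 (x ^ j + 0)) := by
    refine tendsto_const_nhds.add (squeeze_zero_norm (fun n => ?_) (by simpa using he.norm))
    simpa [OrthoPoly.norm_toL2_orthonormalPoly hcompact hinf] using
      norm_inner_le_norm (𝕜 := ℂ) (OrthoPoly.toL2 hcompact (OrthoPoly.orthonormalPoly μ n))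
        (OrthoPoly.toL2 hcompact (e n))
  rw [add_zero] at hlim
  -- The integral is exactly `x ^ j + ⟨φ_n, e n⟩`, as `p n` is orthogonal to `φ_n`.
  refine hlim.congr fun n => ?_
  rw [OrthoPoly.integral_pow_mul_norm_sq_eq_inner hcompact, hep n, map_add, map_add, map_smul,
    inner_add_right, inner_add_right, inner_smul_right, inner_self_eq_norm_sq_to_K,
    OrthoPoly.norm_toL2_orthonormalPoly hcompact hinf,
    OrthoPoly.inner_orthonormalPoly_of_degree_lt hcompact hinf (hp n)]
  simp
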